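/- **Model.** Let $f\ge 0$ and consider $n=3f+1$ replicas, a set of at most $f$ of which is *byzantine*; the others are *correct*, i.e. follow the FnF-BFT protocol below. Communication is asynchronous: messages may be delayed arbitrarily, reordered, duplicated or lost, and timers may expire at any moment. Clients, correct or byzantine, may broadcast any requests at any time. Byzantine replicas may sign and send anything at any time but cannot forge signatures of correct replicas. A combined threshold signature $\sigma(m)$ exists exactly if $2f+1$ distinct replicas have produced partial signatures $\sigma_w(m)$; every replica can then use it. $h$ is a hash function. **Protocol.** The protocol runs in epochs $e=1,2,\dots$; every epoch has a primary $p_e$ and a configuration, which assigns non-overlapping lists of sequence numbers and hash buckets to the replicas in their role as leaders. The $i$-th sequence number in the list of $v$ has local sequence number $i$. Loads, assignments and primaries may be chosen by any policy. *Epoch operation.* For a request $r$ submitted by an authorized client whose bucket belongs to it, leader $v$ sends $\langle\text{pre-prepare},sn,e,h(r),v\rangle$, at most one for each $(sn,e)$. A correct replica $w$ participating in epoch $e$ accepts it if $v$ leads $sn$ in $e$, $sn$ is not the number of a hanging request, the local sequence number of $sn$ exceeds that of the last stable checkpoint of $v$ in epoch $e$ by at least $1$ and at most $2k$, $r$ is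 authorized and in a bucket of $v$, and $w$ has not prepared another request with sequence number $sn$ in epoch $e$. It then signs $\sigma_w(d)$, $d=h(sn\|e\|r)$. A prepared-certificate $\langle sn,e,\sigma(d)\rangle$ of the current epoch is accepted by logging it and signing $\sigma_w(\sigma(d))$. On a commit-certificate $\langle sn,e,\sigma(\sigma(d))\rangle$ of the current epoch, the replica logs it and *commits* request $r$ with sequence number $sn$. *Checkpoints.* A replica that has committed all sequence numbers of $v$ in its current epoch with local number up to $j$, $k\mid j$, may sign a checkpoint for $v$, the epoch and $j$ with the digest of the requests since the previous checkpoint. With $2f+1$ signatures the checkpoint is stable and includes all these sequence numbers; a replica that knows it may obtain the requests matching the digest from others and commit them. *Epoch-change.* At any time a correct replica may stop participating in its epoch and call a later epoch $e$, by a signed epoch-change message with certificates of stable checkpoints known to it and, for the sequence numbers not included in these, all its logged commit-certificates ($\mathcal Q$) and its prepared-certificates for requests without logged commit-certificate ($\mathcal P$). The primary $p_e$ fixes the configuration of $e$ by a three-phase reliable broadcast (init; echo; ready after $2f+1$ echo or $f+1$ ready messages; delivery after $2f+1$ ready messages) and sends $\langle\text{new-epoch},e,\mathcal V,\mathcal O,p_e\rangle$.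 Here $\mathcal V$ consists of signed epoch-change messages for $e$ of at least $2f+1$ replicas, containing only existing certificates from epochs before $e$. For each $sn$ not included in a stable checkpoint in $\mathcal V$, $\mathcal O$ contains: a commit-certificate for $sn$ from $\mathcal V$ if there is one; otherwise, if $\mathcal V$ has a prepared-certificate for $sn$, a pre-prepare for the request of one with highest epoch; otherwise a pre-prepare for the null request or, if $sn$ is to be assigned afresh, nothing. The configuration must assign every sequence number with such a pre-prepare (hanging request), for a client request to the leader of its bucket, and none that has a commit-certificate in $\mathcal O$ or is included in a stable checkpoint in $\mathcal V$; it must name the senders of $\mathcal V$. A correct replica that has not yet entered $e$ and is not in a later epoch may, after verifying all this, enter $e$. It then logs the certificates in $\mathcal O$ and the checkpoints in $\mathcal V$, commits the requests with a commit-certificate in $\mathcal O$, and may sign $\sigma_w(h(sn\|e\|r))$ for each hanging request $r$ in $\mathcal O$ unless it has prepared another request with sequence number $sn$ in epoch $e$. **Theorem (safety).** Consider any finite execution in which no two distinct inputs hashed by correct replicas have the same hash value. If two correct replicas $u,v$ have committed requests $r$ and $r'$, respectively, with the same sequence number $sn$ (in the same or different epochs, null requests included), then $r=r'$. -/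

import Mathlib

/-!
A model of the parallel-leader byzantine fault-tolerant protocol FnF-BFT in an asynchronous
network, as a transition system.

* Network. All signed messages ever sent form a growing set, the pool. A replica may act on any
  subset of the pool, at any time and in any order: messages can be delayed, reordered, duplicated
  or lost.
* Signatures. An element `(w, m)` of the pool is the message `m` with the (partial) signature of
  `w`. Only a step of `w` adds `(w, m)` if `w` is correct; a byzantine `w` can add `(w, m)` for
  every `m` at every time. A combined `(2f+1, n)` threshold signature on `m` exists exactly if
  `2f+1` distinct replicas have signed `m` (`Quorum`), and then anyone may use it.
* Timers. A correct replica may call an epoch-change at any time and for any later epoch, so that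
  every timer policy is covered. The loads `C_v(e)`, and with them the assignment of sequence
  numbers and buckets, may likewise be chosen in any way, which covers every load policy.
* Hashing. The hash function is an arbitrary function. The state records the inputs to which
  correct replicas apply it, so that one can say that no collision occurs among them.
-/

namespace FnF

/-- The `n = 3f+1` replicas. -/
abbrev Replica (f : ℕ) := Fin (3 * f + 1)

/-- A client request: operation, timestamp, client. -/
structure Request (Op Client : Type*) where
  op : Op
  time : ℕ
  client : Client

/-- What a sequence number can be decided to hold: a client request, or the null request `none`,
whose execution is a no-op. -/
abbrev Value (Op Client : Type*) := Option (Request Op Client)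

/-- A request at a sequence number in an epoch. It also stands for the prepared-certificate or
commit-certificate `⟨sn, e, ·⟩` of that request. -/
structure Slot (Op Client : Type*) where
  sn : ℕ
  epoch : ℕ
  req : Value Op Client

/-- The inputs of the cryptographic hash function: a request `r`, a concatenation `sn ‖ e ‖ r`,
and the requests of a checkpoint interval. -/
inductive HashInput (Op Client : Type*) where
  | request (r : Value Op Client)
  | slot (t : Slot Op Client)
  | segment (l : List (ℕ × Value Op Client))

/-- The configuration of an epoch. `seqs v` lists the sequence numbers assigned to leader `v`; the
number at position `i` (from `0`) has local sequence number `i + 1`, and `C_v` is the length.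
`bucketLeader` assigns the hash buckets to leaders, `senders` names the replicas whose epoch-change
messages the primary uses, and `performance` is the reported number of requests committed in the
previous epoch. -/
structure Config (f : ℕ) where
  seqs : Replica f → List ℕ
  bucketLeader : ℕ → Replica f
  senders : Finset (Replica f)
  performance : ℕ

/-- The data of a checkpoint of `leader` in `epoch`: `sns` are the sequence numbers of this leader
in this epoch with local sequence number up to that of the checkpoint (so `sns.length` is the local
sequence number of the checkpoint), and `digest` is the hash of the requests since the previous
checkpoint. -/
structure Checkpoint (f : ℕ) (D : Type*) where
  leader : Replica f
  epoch : ℕ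
  sns : List ℕ
  digest : D

/-- The sets `C`, `P`, `Q` of an epoch-change message: checkpoint-certificates,
prepared-certificates and commit-certificates. The vector `S` can be read off from `C`. -/
structure EpochChange (f : ℕ) (Op Client D : Type*) where
  C : Set (Checkpoint f D)
  P : Set (Slot Op Client)
  Q : Set (Slot Op Client)

/-- An element of the set `O` of a new-epoch message, for a given sequence number: the
commit-certificate of a request in some earlier epoch, or a new pre-prepare for a request. -/
inductive OEntry (Op Client : Type*) where
  | commitCert (e : ℕ) (r : Value Op Client)
  | prePrepare (r : Value Op Client)

/-- The contents that replicas sign. For `d = h(sn ‖ e ‖ r)`, the partial signature `σ_w(d)` of a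
prepare message is `(w, prepare d)`, and the partial signature `σ_w(σ(d))` of a commit message is
`(w, commit d)`. -/
inductive Msg (f : ℕ) (Op Client D : Type*) where
  | prePrepare (sn e : ℕ) (d : D)
  | prepare (d : D)
  | commit (d : D)
  | checkpoint (c : Checkpoint f D)
  | epochChange (e : ℕ) (ec : EpochChange f Op Client D)
  | bcastInit (e : ℕ) (cfg : Config f)
  | bcastEcho (e : ℕ) (cfg : Config f)
  | bcastReady (e : ℕ) (cfg : Config f)
  | newEpoch (e : ℕ) (V : Replica f → Option (EpochChange f Op Client D))
      (O : ℕ → Option (OEntry Op Client))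

/-- The signed messages sent so far. -/
abbrev Pool (f : ℕ) (Op Client D : Type*) := Set (Replica f × Msg f Op Client D)

/-- The local state of a replica. `active` says that it participates in `epoch` (it does not between
calling an epoch-change and accepting a new-epoch message); `signed` are the proposals for which it
has sent a prepare signature; `cfg` and `O` are the configuration and
the set `O` with which it entered `epoch`; `prepared`, `commitCerts` and `ckpts` are the
prepared-, commit- and checkpoint-certificates it has accepted; `committed` holds the pairs
`(sn, r)` such that it has committed request `r` with sequence number `sn`. -/
structure Local (f : ℕ) (Op Client D : Type*) where
  epoch : ℕ
  active : Prop
  cfg : Config f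
  O : ℕ → Option (OEntry Op Client)
  signed : Set (Slot Op Client)
  prepared : Set (Slot Op Client)
  commitCerts : Set (Slot Op Client)
  ckpts : Set (Checkpoint f D)
  committed : Set (ℕ × Value Op Client)

/-- A global state: messages sent by replicas, requests sent by clients, local states, and the
inputs to which correct replicas have applied the hash function (a record without influence on the
execution). -/
structure State (f : ℕ) (Op Client D : Type*) where
  pool : Pool f Op Client D
  requests : Set (Request Op Client)
  loc : Replica f → Local f Op Client D
  hashed : Set (HashInput Op Client)

/-- The fixed data of an execution: checkpoint period `k`, hash function, hash bucket of each
client, authorized clients, primary of each epoch, configuration of the first epoch. -/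
structure Setup (f : ℕ) (Op Client D : Type*) where
  k : ℕ
  hash : HashInput Op Client → D
  bucketOf : Client → ℕ
  authorized : Set Client
  primary : ℕ → Replica f
  config₁ : Config f

section Protocol

variable {f : ℕ} {Op Client D : Type*}

/-- The digest `d = h(sn ‖ e ‖ r)`. -/
def Setup.digest (S : Setup f Op Client D) (t : Slot Op Client) : D := S.hash (.slot t)

/-- `m` carries a combined threshold signature: it is signed by `2f+1` distinct replicas. -/
def Quorum (pool : Pool f Op Client D) (m : Msg f Op Client D) : Prop :=
  ∃ U : Finset (Replica f), 2 * f + 1 ≤ U.card ∧ ∀ w ∈ U, (w, m) ∈ pool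

/-- `⟨prepared-certificate, sn, e, σ(d)⟩` with `d = h(sn ‖ e ‖ r)` exists. -/
def PreparedCert (S : Setup f Op Client D) (pool : Pool f Op Client D) (t : Slot Op Client) :
    Prop :=
  Quorum pool (.prepare (S.digest t))

/-- `⟨commit-certificate, sn, e, σ(σ(d))⟩` with `d = h(sn ‖ e ‖ r)` exists. -/
def CommitCert (S : Setup f Op Client D) (pool : Pool f Op Client D) (t : Slot Op Client) : Prop :=
  Quorum pool (.commit (S.digest t))

/-- A checkpoint-certificate for `c` exists. -/
def CheckpointCert (pool : Pool f Op Client D) (c : Checkpoint f D) : Prop :=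
  Quorum pool (.checkpoint c)

/-- The sequence number `sn` is included in one of the checkpoints in `C`. -/
def Covered (C : Set (Checkpoint f D)) (sn : ℕ) : Prop := ∃ c ∈ C, sn ∈ c.sns

/-- The epoch-change message `ec` is valid for epoch `e`: the certificates it contains exist and
come from earlier epochs. -/
structure ValidEpochChange (S : Setup f Op Client D) (pool : Pool f Op Client D) (e : ℕ)
    (ec : EpochChange f Op Client D) : Prop where
  ckpt : ∀ c ∈ ec.C, c.epoch < e ∧ CheckpointCert pool c
  prepared : ∀ t ∈ ec.P, t.epoch < e ∧ PreparedCert S pool t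
  committed : ∀ t ∈ ec.Q, t.epoch < e ∧ CommitCert S pool t

/-- Some checkpoint in the epoch-change messages `V` includes `sn`. -/
def StableIn (V : Replica f → Option (EpochChange f Op Client D)) (sn : ℕ) : Prop :=
  ∃ w, ∃ ec, V w = some ec ∧ Covered ec.C sn

/-- `t` is one of the prepared-certificates in the epoch-change messages `V`. -/
def PreparedIn (V : Replica f → Option (EpochChange f Op Client D)) (t : Slot Op Client) : Prop :=
  ∃ w, ∃ ec, V w = some ec ∧ t ∈ ec.P

/-- `t` is one of the commit-certificates in the epoch-change messages `V`. -/
def CommittedIn (V : Replica f → Option (EpochChange f Op Client D)) (t : Slot Op Client) : Prop :=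
  ∃ w, ∃ ec, V w = some ec ∧ t ∈ ec.Q

/-- The set `O` is computed correctly from `V`. A sequence number that no stable checkpoint in `V`
includes gets
(a) a commit-certificate from `V`, if `V` has one for it;
(b) otherwise a pre-prepare for the request with the prepared-certificate of highest epoch in `V`,
    if `V` has a prepared-certificate for it;
(c) otherwise a pre-prepare for the null request, or nothing. Nothing is meant for the sequence
    numbers beyond the last one in use, which can be assigned afresh; where these begin is left to
    the primary. -/
structure CorrectO (V : Replica f → Option (EpochChange f Op Client D))
    (O : ℕ → Option (OEntry Op Client)) : Prop where
  stable : ∀ sn, StableIn V sn → O sn = none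
  committed : ∀ sn, ¬ StableIn V sn → (∃ t, CommittedIn V t ∧ t.sn = sn) →
    ∃ t, CommittedIn V t ∧ t.sn = sn ∧ O sn = some (.commitCert t.epoch t.req)
  prepared : ∀ sn, ¬ StableIn V sn → (¬ ∃ t, CommittedIn V t ∧ t.sn = sn) →
    (∃ t, PreparedIn V t ∧ t.sn = sn) →
    ∃ t, PreparedIn V t ∧ t.sn = sn ∧ (∀ t', PreparedIn V t' → t'.sn = sn → t'.epoch ≤ t.epoch) ∧
      O sn = some (.prePrepare t.req)
  unused : ∀ sn, ¬ StableIn V sn → (¬ ∃ t, CommittedIn V t ∧ t.sn = sn) →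
    (¬ ∃ t, PreparedIn V t ∧ t.sn = sn) → O sn = some (.prePrepare none) ∨ O sn = none

/-- The configuration matches `V` and `O`: `V` holds the epoch-change messages of the announced
senders; the sequence numbers of the leaders do not overlap; every hanging request is assigned, to
the leader of its bucket (null requests: to any leader); stable and committed sequence numbers are
not assigned again. -/
structure Matches (S : Setup f Op Client D) (cfg : Config f)
    (V : Replica f → Option (EpochChange f Op Client D)) (O : ℕ → Option (OEntry Op Client)) :
    Prop where
  senders : ∀ w, w ∈ cfg.senders ↔ (V w).isSome
  nodup : ∀ v, (cfg.seqs v).Nodup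
  disjoint : ∀ v v', v ≠ v' → (cfg.seqs v).Disjoint (cfg.seqs v')
  hanging : ∀ sn r, O sn = some (.prePrepare (some r)) →
    sn ∈ cfg.seqs (cfg.bucketLeader (S.bucketOf r.client))
  hangingNull : ∀ sn, O sn = some (.prePrepare none) → ∃ v, sn ∈ cfg.seqs v
  available : ∀ v, ∀ sn ∈ cfg.seqs v, ¬ StableIn V sn ∧ ∀ e r, O sn ≠ some (.commitCert e r)

/-- The reliable broadcast of the configuration `cfg` for epoch `e` delivers `cfg`. -/
def Delivered (pool : Pool f Op Client D) (e : ℕ) (cfg : Config f) : Prop :=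
  Quorum pool (.bcastReady e cfg)

/-- The checks on the new-epoch message `⟨new-epoch, e, V, O⟩`, for the configuration `cfg` of
epoch `e`. -/
structure ValidNewEpoch (S : Setup f Op Client D) (pool : Pool f Op Client D) (e : ℕ)
    (V : Replica f → Option (EpochChange f Op Client D)) (O : ℕ → Option (OEntry Op Client))
    (cfg : Config f) : Prop where
  delivered : Delivered pool e cfg
  enough : 2 * f + 1 ≤ cfg.senders.card
  valid : ∀ w ec, V w = some ec → (w, .epochChange e ec) ∈ pool ∧ ValidEpochChange S pool e ec
  correct : CorrectO V O
  matching : Matches S cfg V O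

/-- `v` leads `sn` in the current epoch of `L`, and `sn` lies between the low and high watermarks of
`v`: its local sequence number is above that of the last stable checkpoint of `v` in this epoch, by
at most `2k`. -/
def InWindow (k : ℕ) (L : Local f Op Client D) (v : Replica f) (sn : ℕ) : Prop :=
  ∃ i, (L.cfg.seqs v)[i]? = some sn ∧
    (∀ c ∈ L.ckpts, c.leader = v → c.epoch = L.epoch → c.sns.length < i + 1) ∧
    ∃ low, (low = 0 ∨ ∃ c ∈ L.ckpts, c.leader = v ∧ c.epoch = L.epoch ∧ c.sns.length = low) ∧
      i + 1 ≤ low + 2 * k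

/-- A replica with local state `L` may handle the new client request `r` of leader `v` with sequence
number `sn`: it participates in its epoch, `sn` is within the watermarks of `v` and not reserved by
the new-epoch message, and `r` was submitted by an authorized client and is in a bucket of `v`. -/
structure Acceptable (S : Setup f Op Client D) (s : State f Op Client D)
    (L : Local f Op Client D) (v : Replica f) (sn : ℕ) (r : Request Op Client) : Prop where
  active : L.active
  window : InWindow S.k L v sn
  fresh : L.O sn = none
  submitted : r ∈ s.requests
  authorized : r.client ∈ S.authorized
  bucket : L.cfg.bucketLeader (S.bucketOf r.client) = v

/-- A replica with local state `L` has not prepared another request than that of `t` with the same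
sequence number in the same epoch. -/
def NoConflict (L : Local f Op Client D) (t : Slot Op Client) : Prop :=
  ∀ t' ∈ L.signed, t'.sn = t.sn → t'.epoch = t.epoch → t'.req = t.req

/-- The inputs that are hashed to verify the certificates in `V`. -/
def hashedIn (V : Replica f → Option (EpochChange f Op Client D)) : Set (HashInput Op Client) :=
  {x | ∃ t, (PreparedIn V t ∨ CommittedIn V t) ∧ x = .slot t}

/-- The hash function is applied to the inputs in `X`. -/
def State.applyHash (s : State f Op Client D) (X : Set (HashInput Op Client)) :
    State f Op Client D :=
  { s with hashed := s.hashed ∪ X }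

/-- Replica `w` signs and sends `m`. -/
def State.send (s : State f Op Client D) (w : Replica f) (m : Msg f Op Client D) :
    State f Op Client D :=
  { s with pool := insert (w, m) s.pool }

/-- The local state of `w` becomes `L`. -/
def State.setLoc (s : State f Op Client D) (w : Replica f) (L : Local f Op Client D) :
    State f Op Client D :=
  { s with loc := Function.update s.loc w L }

/-- The epoch-change message of a replica with local state `L` that reports the stable checkpoints
`C`: for the sequence numbers outside of these, all its commit-certificates, and its
prepared-certificates of the requests for which it has no commit-certificate. -/
def Local.epochChange (L : Local f Op Client D) (C : Set (Checkpoint f D)) :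
    EpochChange f Op Client D where
  C := C
  P := {t | t ∈ L.prepared ∧ ¬ Covered C t.sn ∧
    ¬ ∃ t' ∈ L.commitCerts, t'.sn = t.sn ∧ t'.req = t.req}
  Q := {t | t ∈ L.commitCerts ∧ ¬ Covered C t.sn}

/-- The local state after accepting `⟨new-epoch, e, V, O⟩` with configuration `cfg`: epoch `e` is
entered, the commit-certificates in `O` and the checkpoint-certificates in `V` are logged, and the
requests with a commit-certificate in `O` are committed. -/
def Local.enter (L : Local f Op Client D) (e : ℕ)
    (V : Replica f → Option (EpochChange f Op Client D)) (O : ℕ → Option (OEntry Op Client))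
    (cfg : Config f) : Local f Op Client D where
  epoch := e
  active := True
  cfg := cfg
  O := O
  signed := L.signed
  prepared := L.prepared
  commitCerts := L.commitCerts ∪ {t | O t.sn = some (.commitCert t.epoch t.req)}
  ckpts := L.ckpts ∪ {c | ∃ w, ∃ ec, V w = some ec ∧ c ∈ ec.C}
  committed := L.committed ∪ {p | ∃ e', O p.1 = some (.commitCert e' p.2)}

/-- One step of the system, with the set `byz` of byzantine replicas. -/
inductive Step (S : Setup f Op Client D) (byz : Finset (Replica f)) :
    State f Op Client D → State f Op Client D → Prop
  /-- A byzantine replica signs and sends anything. -/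
  | byzantine (s) (b : Replica f) (hb : b ∈ byz) (m : Msg f Op Client D) :
      Step S byz s (s.send b m)
  /-- A client, correct or byzantine, broadcasts a request. -/
  | request (s) (r : Request Op Client) :
      Step S byz s { s with requests := insert r s.requests }
  /-- Leader prepare phase: leader `v` proposes a request; at most one for each sequence number in
  an epoch. -/
  | propose (s) (v : Replica f) (hv : v ∉ byz) (sn : ℕ) (r : Request Op Client)
      (hacc : Acceptable S s (s.loc v) v sn r)
      (hone : ∀ d, (v, .prePrepare sn (s.loc v).epoch d) ∈ s.pool → d = S.hash (.request (some r))) :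
      Step S byz s
        ((s.applyHash {.request (some r)}).send v
          (.prePrepare sn (s.loc v).epoch (S.hash (.request (some r)))))
  /-- Backup prepare phase: `w` accepts a pre-prepare of leader `v` for its current epoch and signs
  the digest. For `w = v` this is the leader's own partial signature. -/
  | prepare (s) (w : Replica f) (hw : w ∉ byz) (v : Replica f) (sn : ℕ) (r : Request Op Client)
      (hmsg : (v, .prePrepare sn (s.loc w).epoch (S.hash (.request (some r)))) ∈ s.pool)
      (hacc : Acceptable S s (s.loc w) v sn r)
      (t : Slot Op Client) (ht : t = ⟨sn, (s.loc w).epoch, some r⟩)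
      (hno : NoConflict (s.loc w) t) :
      Step S byz s
        (((s.applyHash {.request (some r), .slot t}).setLoc w
          { s.loc w with signed := insert t (s.loc w).signed }).send w (.prepare (S.digest t)))
  /-- The same for a hanging request, whose pre-prepare is in the new-epoch message with which `w`
  entered its epoch. -/
  | prepareHanging (s) (w : Replica f) (hw : w ∉ byz) (sn : ℕ) (r : Value Op Client)
      (hact : (s.loc w).active)
      (hO : (s.loc w).O sn = some (.prePrepare r))
      (t : Slot Op Client) (ht : t = ⟨sn, (s.loc w).epoch, r⟩)
      (hno : NoConflict (s.loc w) t) :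
      Step S byz s
        (((s.applyHash {.slot t}).setLoc w
          { s.loc w with signed := insert t (s.loc w).signed }).send w (.prepare (S.digest t)))
  /-- Commit phase: `w` accepts a prepared-certificate of its current epoch and signs it. -/
  | acceptPrepared (s) (w : Replica f) (hw : w ∉ byz) (t : Slot Op Client)
      (hact : (s.loc w).active) (he : t.epoch = (s.loc w).epoch)
      (hcert : PreparedCert S s.pool t) :
      Step S byz s
        (((s.applyHash {.slot t}).setLoc w
          { s.loc w with prepared := insert t (s.loc w).prepared }).send w (.commit (S.digest t)))
  /-- `w` accepts a commit-certificate of its current epoch and commits the request. -/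
  | acceptCommit (s) (w : Replica f) (hw : w ∉ byz) (t : Slot Op Client)
      (hact : (s.loc w).active) (he : t.epoch = (s.loc w).epoch)
      (hcert : CommitCert S s.pool t) :
      Step S byz s
        ((s.applyHash {.slot t}).setLoc w { s.loc w with
          commitCerts := insert t (s.loc w).commitCerts
          committed := insert (t.sn, t.req) (s.loc w).committed })
  /-- `w` has committed all requests of leader `v` with local sequence number up to `j`, a multiple
  of `k`, and sends a checkpoint message with the digest of the requests from the previous
  checkpoint on. -/
  | sendCheckpoint (s) (w : Replica f) (hw : w ∉ byz) (v : Replica f) (j : ℕ)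
      (l : List (ℕ × Value Op Client))
      (hact : (s.loc w).active) (hj : 0 < j) (hk : S.k ∣ j)
      (hlen : j ≤ ((s.loc w).cfg.seqs v).length)
      (hall : ∀ sn ∈ ((s.loc w).cfg.seqs v).take j, ∃ r, (sn, r) ∈ (s.loc w).committed)
      (hseg : l.map Prod.fst = (((s.loc w).cfg.seqs v).take j).drop (j - S.k - 1))
      (hl : ∀ p ∈ l, p ∈ (s.loc w).committed) :
      Step S byz s
        ((s.applyHash {.segment l}).send w (.checkpoint
          ⟨v, (s.loc w).epoch, ((s.loc w).cfg.seqs v).take j, S.hash (.segment l)⟩))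
  /-- `w` sees a checkpoint-certificate: the checkpoint is stable. -/
  | acceptCheckpoint (s) (w : Replica f) (hw : w ∉ byz) (c : Checkpoint f D)
      (he : c.epoch ≤ (s.loc w).epoch) (hcert : CheckpointCert s.pool c) :
      Step S byz s (s.setLoc w { s.loc w with ckpts := insert c (s.loc w).ckpts })
  /-- `w` obtains the requests of a stable checkpoint from other replicas, checks them against the
  digest, and commits them. -/
  | commitCheckpoint (s) (w : Replica f) (hw : w ∉ byz) (c : Checkpoint f D)
      (l : List (ℕ × Value Op Client))
      (hc : c ∈ (s.loc w).ckpts) (hl : S.hash (.segment l) = c.digest) :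
      Step S byz s
        ((s.applyHash {.segment l}).setLoc w
          { s.loc w with committed := (s.loc w).committed ∪ {p | p ∈ l} })
  /-- `w` calls an epoch-change for a later epoch `e` and stops participating in its epoch. It
  reports stable checkpoints `C` known to it. -/
  | callEpochChange (s) (w : Replica f) (hw : w ∉ byz) (e : ℕ) (C : Set (Checkpoint f D))
      (he : (s.loc w).epoch < e) (hC : C ⊆ (s.loc w).ckpts) :
      Step S byz s
        ((s.setLoc w { s.loc w with epoch := e, active := False }).send w
          (.epochChange e ((s.loc w).epochChange C)))
  /-- The primary of epoch `e`, having `2f+1` valid epoch-change messages, starts the reliable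
  broadcast of the configuration of epoch `e`. -/
  | broadcastInit (s) (p : Replica f) (hp : p ∉ byz) (e : ℕ) (cfg : Config f)
      (V : Replica f → Option (EpochChange f Op Client D))
      (hprim : p = S.primary e) (hcard : 2 * f + 1 ≤ cfg.senders.card)
      (hsend : ∀ w, w ∈ cfg.senders ↔ (V w).isSome)
      (hec : ∀ w ec, V w = some ec →
        (w, .epochChange e ec) ∈ s.pool ∧ ValidEpochChange S s.pool e ec)
      (hone : ∀ cfg', (p, .bcastInit e cfg') ∈ s.pool → cfg' = cfg) :
      Step S byz s ((s.applyHash (hashedIn V)).send p (.bcastInit e cfg))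
  /-- Second phase of the reliable broadcast. -/
  | broadcastEcho (s) (w : Replica f) (hw : w ∉ byz) (e : ℕ) (cfg : Config f)
      (hinit : (S.primary e, .bcastInit e cfg) ∈ s.pool)
      (hone : ∀ cfg', (w, .bcastEcho e cfg') ∈ s.pool → cfg' = cfg) :
      Step S byz s (s.send w (.bcastEcho e cfg))
  /-- Third phase of the reliable broadcast, after `2f+1` echo or `f+1` ready messages. -/
  | broadcastReady (s) (w : Replica f) (hw : w ∉ byz) (e : ℕ) (cfg : Config f)
      (hecho : Quorum s.pool (.bcastEcho e cfg) ∨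
        ∃ U : Finset (Replica f), f + 1 ≤ U.card ∧ ∀ x ∈ U, (x, .bcastReady e cfg) ∈ s.pool)
      (hone : ∀ cfg', (w, .bcastReady e cfg') ∈ s.pool → cfg' = cfg) :
      Step S byz s (s.send w (.bcastReady e cfg))
  /-- The primary of epoch `e` sends the new-epoch message. -/
  | sendNewEpoch (s) (p : Replica f) (hp : p ∉ byz) (e : ℕ)
      (V : Replica f → Option (EpochChange f Op Client D)) (O : ℕ → Option (OEntry Op Client))
      (cfg : Config f) (hprim : p = S.primary e) (hown : (V p).isSome)
      (hvalid : ValidNewEpoch S s.pool e V O cfg) :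
      Step S byz s ((s.applyHash (hashedIn V)).send p (.newEpoch e V O))
  /-- `w` (possibly the primary itself) accepts a new-epoch message for an epoch that it has not yet
  entered, and enters it. -/
  | acceptNewEpoch (s) (w : Replica f) (hw : w ∉ byz) (e : ℕ)
      (V : Replica f → Option (EpochChange f Op Client D)) (O : ℕ → Option (OEntry Op Client))
      (cfg : Config f)
      (he : (s.loc w).epoch < e ∨ ((s.loc w).epoch = e ∧ ¬ (s.loc w).active))
      (hmsg : (S.primary e, .newEpoch e V O) ∈ s.pool)
      (hvalid : ValidNewEpoch S s.pool e V O cfg) :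
      Step S byz s ((s.applyHash (hashedIn V)).setLoc w ((s.loc w).enter e V O cfg))

/-- The initial state: nothing has been sent, all replicas are in epoch `1`. -/
def Setup.initial (S : Setup f Op Client D) : State f Op Client D where
  pool := ∅
  requests := ∅
  loc := fun _ =>
    { epoch := 1, active := True, cfg := S.config₁, O := fun _ => none, signed := ∅,
      prepared := ∅, commitCerts := ∅, ckpts := ∅, committed := ∅ }
  hashed := ∅

/-- `s` occurs in an execution in which the replicas in `byz` are byzantine and all others
correct. -/
def Reachable (S : Setup f Op Client D) (byz : Finset (Replica f)) (s : State f Op Client D) :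
    Prop :=
  Relation.ReflTransGen (Step S byz) S.initial s

/-- Up to the state `s`, the hash function has shown no collision: no two distinct inputs to which
correct replicas have applied it have the same hash. -/
def NoCollision (S : Setup f Op Client D) (s : State f Op Client D) : Prop :=
  Set.InjOn S.hash s.hashed

/-- In the state `s`, replica `u` has committed the request `r` with sequence number `sn`. -/
def Commits (s : State f Op Client D) (u : Replica f) (sn : ℕ) (r : Value Op Client) : Prop :=
  (sn, r) ∈ (s.loc u).committed

end Protocol

end FnF

/-! Every commitment of a correct replica, whether direct, through a new-epoch message or through a
checkpoint, is backed by a commit-certificate. So it suffices that commit-certificates for one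
sequence number agree (`Inv.commitCert_unique`). A correct replica among the signers has logged a
prepared-certificate for the same slot, which reduces the comparison to a commit-certificate for `t`
and a prepared-certificate for `t'` with `t.epoch ≤ t'.epoch` (`Inv.preparedCert_agrees`).

In equal epochs, the two prepare quorums share a correct replica, which signs at most one request
per sequence number and epoch. For a later epoch the proof is a strong induction on `t'.epoch`. A
correct signer of `t'` relied on a valid new-epoch message with sets `V` and `O`. The commit quorum
of `t` and the senders of `V` share a correct replica, whose epoch-change message shows the number
as stable, as committed, or `t` as prepared (`Inv.reported_of_commitCert`). The first two cases rule
out any proposal, so `O` proposes the request of a prepared-certificate of highest epoch in `V`.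
That epoch is at least `t.epoch` and below `t'.epoch`, so induction applies. Only one new-epoch
message is examined at a time, so it is harmless if signers of the same epoch have accepted
different ones.

Signatures bear only on digests. The invariant therefore records that the slots of signed proposals,
prepared-certificates and commitments were hashed by correct replicas, and `Verified` records the
same for the certificates in `V`. Without collisions, a digest then determines its slot. -/

namespace FnF

variable {f : ℕ} {Op Client D : Type*}

/-! ### Quorums -/

/-- Two sets of `2f+1` replicas share a correct replica. -/
theorem exists_correct_of_card {byz U U' : Finset (Replica f)} (hbyz : byz.card ≤ f)
    (hU : 2 * f + 1 ≤ U.card) (hU' : 2 * f + 1 ≤ U'.card) :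
    ∃ x ∈ U, x ∈ U' ∧ x ∉ byz := by
  have h₁ := Finset.card_union_add_card_inter U U'
  have h₂ : (U ∪ U').card ≤ 3 * f + 1 := by simpa using Finset.card_le_univ (U ∪ U')
  -- The overlap has at least `2(2f+1) - (3f+1) = f+1` elements, more than there are byzantine
  -- replicas.
  obtain ⟨x, hx, hxb⟩ := Finset.exists_mem_notMem_of_card_lt_card
    (show byz.card < (U ∩ U').card by omega)
  exact ⟨x, (Finset.mem_inter.1 hx).1, (Finset.mem_inter.1 hx).2, hxb⟩

theorem Quorum.exists_correct {pool : Pool f Op Client D} {m : Msg f Op Client D}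
    {byz : Finset (Replica f)} (h : Quorum pool m) (hbyz : byz.card ≤ f) :
    ∃ x, x ∉ byz ∧ (x, m) ∈ pool := by
  obtain ⟨U, hU, hm⟩ := h
  obtain ⟨x, hx, -, hxb⟩ := exists_correct_of_card hbyz hU hU
  exact ⟨x, hxb, hm x hx⟩

theorem Quorum.mono {pool pool' : Pool f Op Client D} {m : Msg f Op Client D}
    (h : Quorum pool m) (hp : pool ⊆ pool') : Quorum pool' m :=
  let ⟨U, hU, hm⟩ := h
  ⟨U, hU, fun w hw => hp (hm w hw)⟩

theorem ValidEpochChange.mono {S : Setup f Op Client D} {pool pool' : Pool f Op Client D} {e : ℕ}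
    {ec : EpochChange f Op Client D} (h : ValidEpochChange S pool e ec) (hp : pool ⊆ pool') :
    ValidEpochChange S pool' e ec where
  ckpt c hc := ⟨(h.ckpt c hc).1, (h.ckpt c hc).2.mono hp⟩
  prepared t ht := ⟨(h.prepared t ht).1, (h.prepared t ht).2.mono hp⟩
  committed t ht := ⟨(h.committed t ht).1, (h.committed t ht).2.mono hp⟩

theorem ValidNewEpoch.mono {S : Setup f Op Client D} {pool pool' : Pool f Op Client D} {e : ℕ}
    {V : Replica f → Option (EpochChange f Op Client D)} {O : ℕ → Option (OEntry Op Client)}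
    {cfg : Config f} (h : ValidNewEpoch S pool e V O cfg) (hp : pool ⊆ pool') :
    ValidNewEpoch S pool' e V O cfg where
  delivered := h.delivered.mono hp
  enough := h.enough
  valid w ec hw := ⟨hp (h.valid w ec hw).1, (h.valid w ec hw).2.mono hp⟩
  correct := h.correct
  matching := h.matching

/-! ### The invariant -/

/-- The certificates in some valid new-epoch message for `e` with set `O` and configuration `cfg`
have been verified. -/
def Verified (S : Setup f Op Client D) (pool : Pool f Op Client D)
    (hashed : Set (HashInput Op Client)) (e : ℕ) (O : ℕ → Option (OEntry Op Client))
    (cfg : Config f) : Prop :=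
  ∃ V, ValidNewEpoch S pool e V O cfg ∧ hashedIn V ⊆ hashed

theorem Verified.mono {S : Setup f Op Client D} {pool pool' : Pool f Op Client D}
    {hashed hashed' : Set (HashInput Op Client)} {e : ℕ} {O : ℕ → Option (OEntry Op Client)}
    {cfg : Config f} (h : Verified S pool hashed e O cfg) (hp : pool ⊆ pool')
    (hh : hashed ⊆ hashed') : Verified S pool' hashed' e O cfg :=
  let ⟨V, hV, hV'⟩ := h
  ⟨V, hV.mono hp, hV'.trans hh⟩

/-- A proposal of an epoch after the first is permitted by a verified new-epoch message: it is a
hanging request, or its sequence number is assigned and not reserved. -/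
def Justified (S : Setup f Op Client D) (pool : Pool f Op Client D)
    (hashed : Set (HashInput Op Client)) (t : Slot Op Client) : Prop :=
  ∃ O cfg, Verified S pool hashed t.epoch O cfg ∧
    (O t.sn = some (.prePrepare t.req) ∨ O t.sn = none ∧ ∃ v, t.sn ∈ cfg.seqs v)

/-- What holds of the local state of a correct replica. -/
structure LocalInv (S : Setup f Op Client D) (pool : Pool f Op Client D)
    (hashed : Set (HashInput Op Client)) (L : Local f Op Client D) : Prop where
  epoch_pos : 1 ≤ L.epoch
  entered : L.active → 1 < L.epoch → Verified S pool hashed L.epoch L.O L.cfg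
  signed : ∀ t ∈ L.signed, .slot t ∈ hashed ∧ (1 < t.epoch → Justified S pool hashed t)
  signed_unique : ∀ t ∈ L.signed, NoConflict L t
  prepared : ∀ t ∈ L.prepared, .slot t ∈ hashed ∧ PreparedCert S pool t ∧ 1 ≤ t.epoch
  ckpts : ∀ c ∈ L.ckpts, CheckpointCert pool c
  committed : ∀ p ∈ L.committed, ∃ e, .slot ⟨p.1, e, p.2⟩ ∈ hashed ∧ CommitCert S pool ⟨p.1, e, p.2⟩

theorem LocalInv.mono {S : Setup f Op Client D} {pool pool' : Pool f Op Client D}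
    {hashed hashed' : Set (HashInput Op Client)} {L : Local f Op Client D}
    (h : LocalInv S pool hashed L) (hp : pool ⊆ pool') (hh : hashed ⊆ hashed') :
    LocalInv S pool' hashed' L where
  epoch_pos := h.epoch_pos
  entered ha he := (h.entered ha he).mono hp hh
  signed t ht := ⟨hh (h.signed t ht).1, fun he =>
    let ⟨O, cfg, hV, hO⟩ := (h.signed t ht).2 he
    ⟨O, cfg, hV.mono hp hh, hO⟩⟩
  signed_unique := h.signed_unique
  prepared t ht := ⟨hh (h.prepared t ht).1, (h.prepared t ht).2.1.mono hp, (h.prepared t ht).2.2⟩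
  ckpts c hc := (h.ckpts c hc).mono hp
  committed p hpc :=
    let ⟨e, he, hc⟩ := h.committed p hpc
    ⟨e, hh he, hc.mono hp⟩

/-- What holds of a message sent by a correct replica with local state `L`. -/
def MsgInv (S : Setup f Op Client D) (hashed : Set (HashInput Op Client))
    (L : Local f Op Client D) : Msg f Op Client D → Prop
  | .prepare d => ∃ t ∈ L.signed, S.digest t = d
  | .commit d => ∃ t ∈ L.prepared, S.digest t = d
  | .checkpoint c => ∃ l, .segment l ∈ hashed ∧ S.hash (.segment l) = c.digest ∧
      ∀ p ∈ l, p ∈ L.committed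
  | .epochChange e ec => e ≤ L.epoch ∧ ∀ t ∈ L.prepared, t.epoch < e →
      Covered ec.C t.sn ∨ t ∈ ec.P ∨ ∃ t' ∈ ec.Q, t'.sn = t.sn
  | _ => True

/-- The local state `L'` can arise from `L` in the course of an execution. -/
structure Local.Extends (L L' : Local f Op Client D) : Prop where
  epoch : L.epoch ≤ L'.epoch
  signed : L.signed ⊆ L'.signed
  prepared : L.prepared ⊆ L'.prepared
  prepared_new : ∀ t ∈ L'.prepared, t ∈ L.prepared ∨ L.epoch ≤ t.epoch
  committed : L.committed ⊆ L'.committed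

theorem Local.Extends.refl (L : Local f Op Client D) : L.Extends L :=
  ⟨le_rfl, subset_rfl, subset_rfl, fun _ => Or.inl, subset_rfl⟩

/-- The delicate case is an epoch-change message, whose condition quantifies over a growing set of
prepared-certificates. Its sender has already moved to epoch `e` or beyond, so certificates logged
later have epoch at least `e` and do not fall under the condition: the report stays complete
forever. -/
theorem MsgInv.mono {S : Setup f Op Client D} {hashed hashed' : Set (HashInput Op Client)}
    {L L' : Local f Op Client D} {m : Msg f Op Client D} (h : MsgInv S hashed L m)
    (hh : hashed ⊆ hashed') (hL : L.Extends L') : MsgInv S hashed' L' m := by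
  cases m with
  | prepare d =>
    obtain ⟨t, ht, hd⟩ := h
    exact ⟨t, hL.signed ht, hd⟩
  | commit d =>
    obtain ⟨t, ht, hd⟩ := h
    exact ⟨t, hL.prepared ht, hd⟩
  | checkpoint c =>
    obtain ⟨l, hl, hd, hc⟩ := h
    exact ⟨l, hh hl, hd, fun p hp => hL.committed (hc p hp)⟩
  | epochChange e ec =>
    obtain ⟨he, hr⟩ := h
    refine ⟨he.trans hL.epoch, fun t ht hte => ?_⟩
    rcases hL.prepared_new t ht with ht | ht
    · exact hr t ht hte
    · omega
  | _ => trivial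

/-- The invariant of the protocol. -/
def Inv (S : Setup f Op Client D) (byz : Finset (Replica f)) (s : State f Op Client D) : Prop :=
  ∀ w, w ∉ byz → LocalInv S s.pool s.hashed (s.loc w) ∧
    ∀ m, (w, m) ∈ s.pool → MsgInv S s.hashed (s.loc w) m

/-! ### Initial state and elementary state updates -/

theorem inv_initial (S : Setup f Op Client D) (byz : Finset (Replica f)) :
    Inv S byz S.initial := by
  refine fun w _ => ⟨?_, fun m hm => hm.elim⟩
  constructor <;> simp [Setup.initial]

/-- A step of replica `w` preserves the invariant if the new local state and the new messages of
`w` satisfy it. -/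
theorem Inv.update {S : Setup f Op Client D} {byz : Finset (Replica f)} {s : State f Op Client D}
    (h : Inv S byz s) (w : Replica f) {s' : State f Op Client D} (hp : s.pool ⊆ s'.pool)
    (hh : s.hashed ⊆ s'.hashed) (hloc : ∀ x, x ≠ w → s'.loc x = s.loc x)
    (hw : w ∉ byz → (s.loc w).Extends (s'.loc w) ∧ LocalInv S s'.pool s'.hashed (s'.loc w))
    (hm : ∀ x m, (x, m) ∈ s'.pool → x ∉ byz →
      (x, m) ∈ s.pool ∨ x = w ∧ MsgInv S s'.hashed (s'.loc w) m) :
    Inv S byz s' := by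
  intro x hx
  have hext : (s.loc x).Extends (s'.loc x) ∧ LocalInv S s'.pool s'.hashed (s'.loc x) := by
    by_cases hxw : x = w
    · subst hxw
      exact hw hx
    · rw [hloc x hxw]
      exact ⟨.refl _, (h x hx).1.mono hp hh⟩
  refine ⟨hext.2, fun m hxm => ?_⟩
  rcases hm x m hxm hx with hxm | ⟨rfl, hxm⟩
  · exact ((h x hx).2 m hxm).mono hh hext.1
  · exact hxm

/-- Together with `Inv.applyHash` and `Inv.setLoc`, this splits a protocol step into hashing, local
update and sending. As sending comes last, a new message is checked against the local state that
already records what it attests. -/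
theorem Inv.send {S : Setup f Op Client D} {byz : Finset (Replica f)} {s : State f Op Client D}
    (h : Inv S byz s) (w : Replica f) {m : Msg f Op Client D}
    (hm : w ∉ byz → MsgInv S s.hashed (s.loc w) m) : Inv S byz (s.send w m) := by
  refine h.update w (Set.subset_insert _ _) subset_rfl (fun _ _ => rfl)
    (fun hw => ⟨.refl _, (h w hw).1.mono (Set.subset_insert _ _) subset_rfl⟩) ?_
  intro x m' hx hxb
  rcases hx with hx | hx
  · obtain ⟨rfl, rfl⟩ := Prod.ext_iff.1 hx
    exact Or.inr ⟨rfl, hm hxb⟩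
  · exact Or.inl hx

theorem Inv.applyHash {S : Setup f Op Client D} {byz : Finset (Replica f)}
    {s : State f Op Client D} (h : Inv S byz s) (X : Set (HashInput Op Client)) :
    Inv S byz (s.applyHash X) := fun w hw =>
  ⟨(h w hw).1.mono subset_rfl Set.subset_union_left, fun m hm =>
    ((h w hw).2 m hm).mono Set.subset_union_left (.refl _)⟩

theorem Inv.setLoc {S : Setup f Op Client D} {byz : Finset (Replica f)} {s : State f Op Client D}
    (h : Inv S byz s) (w : Replica f) {L : Local f Op Client D} (hL : (s.loc w).Extends L)
    (hinv : LocalInv S s.pool s.hashed L) : Inv S byz (s.setLoc w L) := by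
  refine h.update w subset_rfl subset_rfl (fun x hx => Function.update_of_ne hx _ _)
    (fun _ => ?_) (fun x m hx _ => Or.inl hx)
  simpa [State.setLoc] using ⟨hL, hinv⟩

/-- Signing a justified proposal without conflict preserves the local invariant. -/
theorem LocalInv.sign {S : Setup f Op Client D} {pool : Pool f Op Client D}
    {hashed : Set (HashInput Op Client)} {L : Local f Op Client D} (h : LocalInv S pool hashed L)
    {t : Slot Op Client} (ht : .slot t ∈ hashed) (hj : 1 < t.epoch → Justified S pool hashed t)
    (hno : NoConflict L t) :
    LocalInv S pool hashed { L with signed := insert t L.signed } where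
  epoch_pos := h.epoch_pos
  entered := h.entered
  signed := by
    rintro t' (rfl | ht')
    · exact ⟨ht, hj⟩
    · exact h.signed t' ht'
  signed_unique := by
    rintro t₁ (rfl | h₁) t₂ (rfl | h₂) hsn he
    · rfl
    · exact hno t₂ h₂ hsn he
    · exact (hno t₁ h₁ hsn.symm he.symm).symm
    · exact h.signed_unique t₁ h₁ t₂ h₂ hsn he
  prepared := h.prepared
  ckpts := h.ckpts
  committed := h.committed

theorem Local.Extends.sign (L : Local f Op Client D) (t : Slot Op Client) :
    L.Extends { L with signed := insert t L.signed } :=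
  ⟨le_rfl, Set.subset_insert _ _, subset_rfl, fun _ => Or.inl, subset_rfl⟩

/-! ### Preservation of the invariant along executions -/

/-- Absence of collisions in the final state thereby passes to all earlier states, as the induction
along an execution requires. -/
theorem Step.hashed_subset {S : Setup f Op Client D} {byz : Finset (Replica f)}
    {s s' : State f Op Client D} (h : Step S byz s s') : s.hashed ⊆ s'.hashed := by
  cases h <;> first | exact subset_rfl | exact Set.subset_union_left

/-- Requests obtained for a checkpoint have commit-certificates, unless the hash function shows a
collision. -/
theorem Inv.commitCert_of_checkpoint {S : Setup f Op Client D} {byz : Finset (Replica f)}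
    (hbyz : byz.card ≤ f) {s : State f Op Client D} (h : Inv S byz s) (hnc : NoCollision S s)
    {c : Checkpoint f D} (hc : CheckpointCert s.pool c) {l : List (ℕ × Value Op Client)}
    (hl : .segment l ∈ s.hashed) (hd : S.hash (.segment l) = c.digest) {p : ℕ × Value Op Client}
    (hp : p ∈ l) :
    ∃ e, .slot ⟨p.1, e, p.2⟩ ∈ s.hashed ∧ CommitCert S s.pool ⟨p.1, e, p.2⟩ := by
  -- A correct signer of the checkpoint hashed its own list of committed requests. Equal digests
  -- make that list equal to `l`, so the signer's commit-certificates serve for `l`.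
  obtain ⟨x, hx, hxc⟩ := hc.exists_correct hbyz
  obtain ⟨l', hl', hd', hcom⟩ := (h x hx).2 _ hxc
  obtain rfl : l = l' := by simpa using hnc hl hl' (hd.trans hd'.symm)
  exact (h x hx).1.committed p (hcom p hp)

/-- The bound on `byz` and the absence of collisions enter when requests fetched for a checkpoint
are committed. In the other steps, the checks made by the acting replica supply what the invariant
asks. -/
theorem Inv.step {S : Setup f Op Client D} {byz : Finset (Replica f)} (hbyz : byz.card ≤ f)
    {s s' : State f Op Client D} (h : Inv S byz s) (hst : Step S byz s s')
    (hnc : NoCollision S s') : Inv S byz s' := by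
  cases hst with
  | byzantine b hb m => exact h.send b fun hb' => (hb' hb).elim
  | request r => exact h
  | propose v hv sn r hacc hone => exact (h.applyHash _).send v fun _ => trivial
  | prepare w hw v sn r hmsg hacc t ht hno =>
    have h' := h.applyHash {.request (some r), .slot t}
    refine (h'.setLoc w (.sign _ t) ((h' w hw).1.sign (by simp [State.applyHash])
      (fun he => ?_) hno)).send w fun _ => ⟨t, by simp [State.setLoc], rfl⟩
    subst ht
    -- The watermark window supplies the membership of `sn` in the list of `v`.
    obtain ⟨i, hi, -⟩ := hacc.window
    exact ⟨_, _, (h' w hw).1.entered hacc.active he,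
      Or.inr ⟨hacc.fresh, v, List.mem_of_getElem? hi⟩⟩
  | prepareHanging w hw sn r hact hO t ht hno =>
    have h' := h.applyHash {.slot t}
    refine (h'.setLoc w (.sign _ t) ((h' w hw).1.sign (by simp [State.applyHash])
      (fun he => ?_) hno)).send w fun _ => ⟨t, by simp [State.setLoc], rfl⟩
    subst ht
    exact ⟨_, _, (h' w hw).1.entered hact he, Or.inl hO⟩
  | acceptPrepared w hw t hact he hcert =>
    have h' := h.applyHash {.slot t}
    have hL := (h' w hw).1
    refine (h'.setLoc w (L := { s.loc w with prepared := insert t (s.loc w).prepared })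
      ⟨le_rfl, subset_rfl, Set.subset_insert _ _, ?_, subset_rfl⟩
      { hL with prepared := ?_ }).send w fun _ => ⟨t, by simp [State.setLoc], rfl⟩
    · rintro t' (rfl | ht')
      -- A newly logged certificate belongs to the current epoch; this is what keeps earlier
      -- epoch-change reports complete.
      · exact Or.inr he.ge
      · exact Or.inl ht'
    · rintro t' (rfl | ht')
      · exact ⟨by simp [State.applyHash], hcert, he ▸ hL.epoch_pos⟩
      · exact hL.prepared t' ht'
  | acceptCommit w hw t hact he hcert =>
    have h' := h.applyHash {.slot t}
    have hL := (h' w hw).1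
    refine h'.setLoc w ⟨le_rfl, subset_rfl, subset_rfl, fun _ => Or.inl, Set.subset_insert _ _⟩
      { hL with committed := ?_ }
    rintro p (rfl | hp)
    · exact ⟨t.epoch, by simp [State.applyHash], hcert⟩
    · exact hL.committed p hp
  | sendCheckpoint w hw v j l hact hj hk hlen hall hseg hl =>
    exact (h.applyHash _).send w fun _ => ⟨l, by simp [State.applyHash], rfl, hl⟩
  | acceptCheckpoint w hw c he hcert =>
    refine h.setLoc w ⟨le_rfl, subset_rfl, subset_rfl, fun _ => Or.inl, subset_rfl⟩
      { (h w hw).1 with ckpts := ?_ }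
    rintro c' (rfl | hc')
    · exact hcert
    · exact (h w hw).1.ckpts c' hc'
  | commitCheckpoint w hw c l hc hl =>
    have h' := h.applyHash {.segment l}
    have hL := (h' w hw).1
    refine h'.setLoc w ⟨le_rfl, subset_rfl, subset_rfl, fun _ => Or.inl, Set.subset_union_left⟩
      { hL with committed := ?_ }
    rintro p (hp | hp)
    · exact hL.committed p hp
    · exact h'.commitCert_of_checkpoint hbyz hnc (hL.ckpts c hc) (by simp [State.applyHash]) hl hp
  | callEpochChange w hw e C he hC =>
    have hL := (h w hw).1
    refine (h.setLoc w (L := { s.loc w with epoch := e, active := False })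
      ⟨he.le, subset_rfl, subset_rfl, fun _ => Or.inl, subset_rfl⟩
      { hL with
        epoch_pos := hL.epoch_pos.trans he.le
        entered := fun ha => ha.elim }).send w fun _ => ?_
    -- At the moment of sending, every logged prepared-certificate is accounted for, whatever its
    -- epoch: it is omitted from `P` only when a checkpoint covers it or a logged commit-certificate
    -- replaces it.
    simp only [MsgInv, State.setLoc, Function.update_self, le_refl, true_and]
    intro t ht _
    by_cases hcov : Covered C t.sn
    · exact Or.inl hcov
    by_cases hq : ∃ t' ∈ (s.loc w).commitCerts, t'.sn = t.sn ∧ t'.req = t.req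
    · obtain ⟨t', ht', hsn, -⟩ := hq
      exact Or.inr (Or.inr ⟨t', ⟨ht', hsn ▸ hcov⟩, hsn⟩)
    · exact Or.inr (Or.inl ⟨ht, hcov, hq⟩)
  | broadcastInit p hp e cfg V hprim hcard hsend hec hone =>
    exact (h.applyHash _).send p fun _ => trivial
  | broadcastEcho w hw e cfg hinit hone => exact h.send w fun _ => trivial
  | broadcastReady w hw e cfg hecho hone => exact h.send w fun _ => trivial
  | sendNewEpoch p hp e V O cfg hprim hown hvalid =>
    exact (h.applyHash _).send p fun _ => trivial
  | acceptNewEpoch w hw e V O cfg he hmsg hvalid =>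
    have h' := h.applyHash (hashedIn V)
    have hL := (h' w hw).1
    have hle : (s.loc w).epoch ≤ e := he.elim le_of_lt fun he => he.1.le
    have hsub : hashedIn V ⊆ (s.applyHash (hashedIn V)).hashed := Set.subset_union_right
    refine h'.setLoc w ⟨hle, subset_rfl, subset_rfl, fun _ => Or.inl, Set.subset_union_left⟩
      { epoch_pos := hL.epoch_pos.trans hle
        entered := fun _ _ => ⟨V, hvalid, hsub⟩
        signed := hL.signed
        signed_unique := hL.signed_unique
        prepared := hL.prepared
        ckpts := ?_
        committed := ?_ }
    · rintro c (hc | ⟨x, ec, hx, hc⟩)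
      · exact hL.ckpts c hc
      · exact ((hvalid.valid x ec hx).2.ckpt c hc).2
    · rintro p (hp | ⟨e', hp⟩)
      · exact hL.committed p hp
      -- A commit-certificate in `O` must stem from `V`, since every other clause of `CorrectO`
      -- yields a pre-prepare or nothing.
      have hst : ¬ StableIn V p.1 := fun hst => by simp [hvalid.correct.stable _ hst] at hp
      have hcom : ∃ t, CommittedIn V t ∧ t.sn = p.1 := by
        by_contra hcom
        by_cases hpre : ∃ t, PreparedIn V t ∧ t.sn = p.1
        · obtain ⟨t, -, -, -, ht⟩ := hvalid.correct.prepared _ hst hcom hpre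
          simp [ht] at hp
        · rcases hvalid.correct.unused _ hst hcom hpre with ht | ht <;> simp [ht] at hp
      obtain ⟨t, ht, hsn, hO⟩ := hvalid.correct.committed _ hst hcom
      have hreq : t.req = p.2 := by
        rw [hO] at hp
        simp only [Option.some.injEq, OEntry.commitCert.injEq] at hp
        exact hp.2
      rw [← hsn, ← hreq]
      have hmem : HashInput.slot t ∈ hashedIn V := ⟨t, Or.inr ht, rfl⟩
      obtain ⟨x, ec, hx, htQ⟩ := ht
      exact ⟨t.epoch, hsub hmem, ((hvalid.valid x ec hx).2.committed t htQ).2⟩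

theorem Reachable.inv {S : Setup f Op Client D} {byz : Finset (Replica f)} (hbyz : byz.card ≤ f)
    {s : State f Op Client D} (hs : Reachable S byz s) (hnc : NoCollision S s) : Inv S byz s := by
  induction hs with
  | refl => exact inv_initial S byz
  | tail _ hst ih => exact (ih (hnc.mono hst.hashed_subset)).step hbyz hst hnc

/-! ### Agreement -/

section Agreement

variable {S : Setup f Op Client D} {byz : Finset (Replica f)} {s : State f Op Client D}

/-- The signature fixes only a digest. The slot that `x` actually signed and `t` were both hashed by
correct replicas, so equal digests identify them. -/
theorem Inv.mem_signed (h : Inv S byz s) (hnc : NoCollision S s) {x : Replica f} (hx : x ∉ byz)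
    {t : Slot Op Client} (ht : .slot t ∈ s.hashed) (hm : (x, .prepare (S.digest t)) ∈ s.pool) :
    t ∈ (s.loc x).signed := by
  obtain ⟨t', ht', hd⟩ := (h x hx).2 _ hm
  obtain rfl : t' = t := by simpa using hnc ((h x hx).1.signed t' ht').1 ht hd
  exact ht'

theorem Inv.mem_prepared (h : Inv S byz s) (hnc : NoCollision S s) {x : Replica f} (hx : x ∉ byz)
    {t : Slot Op Client} (ht : .slot t ∈ s.hashed) (hm : (x, .commit (S.digest t)) ∈ s.pool) :
    t ∈ (s.loc x).prepared := by
  obtain ⟨t', ht', hd⟩ := (h x hx).2 _ hm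
  obtain rfl : t' = t := by simpa using hnc ((h x hx).1.prepared t' ht').1 ht hd
  exact ht'

/-- Prepared-certificates for a sequence number in the same epoch agree. -/
theorem Inv.preparedCert_unique (hbyz : byz.card ≤ f) (h : Inv S byz s) (hnc : NoCollision S s)
    {t t' : Slot Op Client} (ht : .slot t ∈ s.hashed) (ht' : .slot t' ∈ s.hashed)
    (hc : PreparedCert S s.pool t) (hc' : PreparedCert S s.pool t') (hsn : t'.sn = t.sn)
    (he : t'.epoch = t.epoch) : t'.req = t.req := by
  obtain ⟨U, hU, hUm⟩ := hc
  obtain ⟨U', hU', hUm'⟩ := hc'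
  obtain ⟨x, hxU, hxU', hx⟩ := exists_correct_of_card hbyz hU hU'
  exact (h x hx).1.signed_unique t (h.mem_signed hnc hx ht (hUm x hxU)) t'
    (h.mem_signed hnc hx ht' (hUm' x hxU')) hsn he

/-- A commit-certificate comes with a prepared-certificate. -/
theorem Inv.preparedCert_of_commitCert (hbyz : byz.card ≤ f) (h : Inv S byz s)
    (hnc : NoCollision S s) {t : Slot Op Client} (ht : .slot t ∈ s.hashed)
    (hc : CommitCert S s.pool t) : PreparedCert S s.pool t ∧ 1 ≤ t.epoch := by
  obtain ⟨x, hx, hm⟩ := hc.exists_correct hbyz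
  exact ((h x hx).1.prepared t (h.mem_prepared hnc hx ht hm)).2

/-- The epoch-change messages in a new-epoch message for a later epoch account for every request
with a commit-certificate. -/
theorem Inv.reported_of_commitCert (hbyz : byz.card ≤ f) (h : Inv S byz s) (hnc : NoCollision S s)
    {t : Slot Op Client} (ht : .slot t ∈ s.hashed) (hc : CommitCert S s.pool t) {e : ℕ}
    (he : t.epoch < e) {V : Replica f → Option (EpochChange f Op Client D)}
    {O : ℕ → Option (OEntry Op Client)} {cfg : Config f}
    (hV : ValidNewEpoch S s.pool e V O cfg) :
    StableIn V t.sn ∨ PreparedIn V t ∨ ∃ t', CommittedIn V t' ∧ t'.sn = t.sn := by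
  obtain ⟨U, hU, hUm⟩ := hc
  obtain ⟨x, hxU, hxs, hx⟩ := exists_correct_of_card hbyz hU hV.enough
  obtain ⟨ec, hec⟩ := Option.isSome_iff_exists.1 ((hV.matching.senders x).1 hxs)
  -- `x` both signed the commit for `t` and sent a report in `V`. The order of these actions need
  -- not be traced, since the invariant says that the report covers all certificates of epochs below
  -- `e` in the present log of `x`.
  rcases ((h x hx).2 _ (hV.valid x ec hec).1).2 t (h.mem_prepared hnc hx ht (hUm x hxU)) he with
    hr | hr | ⟨t', hr, hsn⟩
  · exact Or.inl ⟨x, ec, hec, hr⟩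
  · exact Or.inr (Or.inl ⟨x, ec, hec, hr⟩)
  · exact Or.inr (Or.inr ⟨t', ⟨x, ec, hec, hr⟩, hsn⟩)

/-- A prepared-certificate agrees with every commit-certificate for its sequence number from the
same or an earlier epoch. -/
theorem Inv.preparedCert_agrees (hbyz : byz.card ≤ f) (h : Inv S byz s) (hnc : NoCollision S s)
    {t : Slot Op Client} (ht : .slot t ∈ s.hashed) (hc : CommitCert S s.pool t) (n : ℕ) :
    ∀ t' : Slot Op Client, t'.epoch = n → .slot t' ∈ s.hashed → PreparedCert S s.pool t' →
      t'.sn = t.sn → t.epoch ≤ t'.epoch → t'.req = t.req := by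
  induction n using Nat.strong_induction_on with
  | _ n ih =>
    rintro t' rfl ht' hc' hsn hle
    obtain ⟨hpc, hpos⟩ := h.preparedCert_of_commitCert hbyz hnc ht hc
    rcases hle.eq_or_lt with he | hlt
    · exact h.preparedCert_unique hbyz hnc ht ht' hpc hc' hsn he.symm
    obtain ⟨x, hx, hm⟩ := hc'.exists_correct hbyz
    obtain ⟨O, cfg, ⟨V, hV, hVh⟩, hO⟩ :=
      ((h x hx).1.signed t' (h.mem_signed hnc hx ht' hm)).2 (by omega)
    rw [hsn] at hO
    -- A stable number has no entry in `O`, so it is not hanging, and the configuration may not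
    -- assign it afresh either.
    have hst : ¬ StableIn V t.sn := by
      intro hst
      rcases hO with hO | ⟨-, v, hv⟩
      · simp [hV.correct.stable _ hst] at hO
      · exact (hV.matching.available v _ hv).1 hst
    -- A reported commit-certificate would force a commit-certificate into `O`, which is neither of
    -- the two entries that permit `t'`.
    have hcom : ¬ ∃ t₁, CommittedIn V t₁ ∧ t₁.sn = t.sn := by
      intro hcom
      obtain ⟨t₁, -, -, h₁⟩ := hV.correct.committed _ hst hcom
      simp [h₁] at hO
    have hpre : PreparedIn V t :=
      ((h.reported_of_commitCert hbyz hnc ht hc hlt hV).resolve_left hst).resolve_right hcom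
    obtain ⟨t₁, hp₁, hsn₁, hmax, h₁⟩ := hV.correct.prepared _ hst hcom ⟨t, hpre, rfl⟩
    have hreq : t₁.req = t'.req := by simpa [h₁] using hO
    -- The reporter of `t₁` may be byzantine, but verification of `V` by a correct replica has
    -- hashed this slot.
    have hh₁ : .slot t₁ ∈ s.hashed := hVh ⟨t₁, Or.inl hp₁, rfl⟩
    obtain ⟨y, ec, hy, hyP⟩ := hp₁
    obtain ⟨hlt₁, hcert₁⟩ := (hV.valid y ec hy).2.prepared t₁ hyP
    rw [← hreq]
    -- Validity of `V` puts `t₁` strictly before `t'`; maximality against `t`, itself reported in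
    -- `V`, puts it no earlier than `t`.
    exact ih t₁.epoch hlt₁ t₁ rfl hh₁ hcert₁ hsn₁ (hmax t hpre rfl)

/-- Commit-certificates for the same sequence number agree. -/
theorem Inv.commitCert_unique (hbyz : byz.card ≤ f) (h : Inv S byz s) (hnc : NoCollision S s)
    {t t' : Slot Op Client} (ht : .slot t ∈ s.hashed) (ht' : .slot t' ∈ s.hashed)
    (hc : CommitCert S s.pool t) (hc' : CommitCert S s.pool t') (hsn : t'.sn = t.sn) :
    t'.req = t.req := by
  -- The commit-certificate of the lower epoch constrains the prepared-certificate behind the other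
  -- one.
  rcases le_total t.epoch t'.epoch with hle | hle
  · exact h.preparedCert_agrees hbyz hnc ht hc _ t' rfl ht'
      (h.preparedCert_of_commitCert hbyz hnc ht' hc').1 hsn hle
  · exact (h.preparedCert_agrees hbyz hnc ht' hc' _ t rfl ht
      (h.preparedCert_of_commitCert hbyz hnc ht hc).1 hsn.symm hle).symm

end Agreement

end FnF

theorem mainTheorem1 {f : ℕ} {Op Client D : Type*} (S : FnF.Setup f Op Client D)
    (byz : Finset (FnF.Replica f)) (at_most_f_byzantine : byz.card ≤ f)
    (s : FnF.State f Op Client D) (hs : FnF.Reachable S byz s)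
    (no_collision : FnF.NoCollision S s)
    (u v : FnF.Replica f) (hu : u ∉ byz) (hv : v ∉ byz)
    (sn : ℕ) (r r' : FnF.Value Op Client)
    (hur : FnF.Commits s u sn r) (hvr : FnF.Commits s v sn r') :
    r = r' := by
  have h := hs.inv at_most_f_byzantine no_collision
  obtain ⟨e, he, hc⟩ := (h u hu).1.committed _ hur
  obtain ⟨e', he', hc'⟩ := (h v hv).1.committed _ hvr
  exact h.commitCert_unique at_most_f_byzantine no_collision he' he hc' hc rfl
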